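/- Let $\Gamma=\mathrm{SL}_2(\mathbb Z)$ act on the upper half-plane $\mathbb H=\{z\in\mathbb C:\operatorname{Im}z>0\}$ by Möbius transformations, let $\mathcal M=\Gamma\backslash\mathbb H$ be the modular surface, and let $d_{\mathcal M}(\Gamma z,\Gamma w)=\inf_{\gamma\in\Gamma}d_{\mathbb H}(\gamma z,w)$ be the distance on $\mathcal M$ induced from the hyperbolic distance $d_{\mathbb H}$ on $\mathbb H$. For a positive integer $n$, $x\in\mathbb R/\mathbb Z$ and $y>0$ put $$\mathcal R_n(x,y)=\left\{\Gamma\left(x+\tfrac jn+iy\right):0\le j\le n-1\right\}\subset\mathcal M .$$ Fix $\Gamma z_0\in\mathcal M$. For any sequence of positive numbers $\{c_n\}_{n\ge1}$ there exists a sequence $\{y_n\}_{n\ge1}$ satisfying $0<y_n<c_n$ for each $n\ge1$ and such that for almost every $x\in\mathbb R/\mathbb Z$ (with respect to Lebesgue measure) $$\limsup_{n\to\infty}\frac{\inf_{\Gamma z\in\mathcal R_n(x,y_n)}d_{\mathcal M}(\Gamma z_0,\Gamma z)}{\log\log n}\ge1 .$$ -/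

import Mathlib

open Filter MeasureTheory
open scoped MatrixGroups UpperHalfPlane

/-- The modular surface `SL(2, ℤ) \ ℍ`, as the space of orbits of `SL(2, ℤ)` acting on the upper
half-plane by Möbius transformations. -/
abbrev ModularSurface : Type := MulAction.orbitRel.Quotient SL(2, ℤ) ℍ

namespace ModularSurface

/-- The projection `z ↦ Γ z` from the upper half-plane to the modular surface. -/
noncomputable def proj (z : ℍ) : ModularSurface := Quotient.mk _ z

theorem proj_smul (γ : SL(2, ℤ)) (z : ℍ) : proj (γ • z) = proj z :=
  Quotient.sound ⟨γ, rfl⟩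

theorem dist_smul_smul (γ : SL(2, ℤ)) (z w : ℍ) : dist (γ • z) (γ • w) = dist z w :=
  dist_smul (γ : SL(2, ℝ)) z w

/-- The distance on the modular surface induced from the hyperbolic distance of `ℍ`:
`d(Γ z, Γ w) = inf_{γ ∈ Γ} d(γ z, w)`. -/
noncomputable def surfaceDist (p q : ModularSurface) : ℝ :=
  Quotient.lift₂ (fun z w : ℍ => ⨅ γ : SL(2, ℤ), dist (γ • z) w)
    (by
      rintro z w z' w' ⟨α, rfl⟩ ⟨β, rfl⟩
      refine Equiv.iInf_congr ((Equiv.mulRight α).trans (Equiv.mulLeft β⁻¹)) fun γ => ?_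
      rw [← dist_smul_smul β]
      simp [mul_smul]) p q

theorem surfaceDist_proj (z w : ℍ) :
    surfaceDist (proj z) (proj w) = ⨅ γ : SL(2, ℤ), dist (γ • z) w := rfl

/-- The point `x + i y` of the upper half-plane, for `y > 0`. -/
def halfPlanePoint (y : ℝ) (hy : 0 < y) (x : ℝ) : ℍ where
  coe := ⟨x, y⟩
  coe_im_pos := hy

theorem periodic_proj (y : ℝ) (hy : 0 < y) :
    Function.Periodic (fun t : ℝ => proj (halfPlanePoint y hy t)) 1 := by
  intro t
  have h : halfPlanePoint y hy (t + 1) = ModularGroup.T • halfPlanePoint y hy t := by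
    apply UpperHalfPlane.ext
    rw [UpperHalfPlane.modular_T_smul, UpperHalfPlane.coe_vadd]
    apply Complex.ext <;> simp [halfPlanePoint, add_comm]
  change proj (halfPlanePoint y hy (t + 1)) = proj (halfPlanePoint y hy t)
  rw [h, proj_smul]

/-- The point `Γ (x + i y)` of the closed horocycle of height `y > 0`, where `x ∈ ℝ / ℤ`. -/
noncomputable def horocyclePoint (y : ℝ) (hy : 0 < y) (x : UnitAddCircle) : ModularSurface :=
  (periodic_proj y hy).lift x

theorem horocyclePoint_coe (y : ℝ) (hy : 0 < y) (t : ℝ) :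
    horocyclePoint y hy (t : UnitAddCircle) =
      proj (halfPlanePoint y hy t) := rfl

/-- The set `R_n(x, y) = {Γ (x + j / n + i y) : 0 ≤ j ≤ n - 1}` of `n` evenly spaced sample points
on the closed horocycle of height `y`, translated by `x ∈ ℝ / ℤ`. -/
def samplePoints (n : ℕ+) (x : UnitAddCircle) (y : ℝ) (hy : 0 < y) : Set ModularSurface :=
  {p | ∃ j : ℕ, j < (n : ℕ) ∧
    p = horocyclePoint y hy (x + (((j : ℝ) / ((n : ℕ) : ℝ) : ℝ) : UnitAddCircle))}

/-- The infimum of the distances from `p` to the points of `R_n(x, y)`. -/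
noncomputable def distToSamplePoints (p : ModularSurface) (n : ℕ+) (x : UnitAddCircle)
    (y : ℝ) (hy : 0 < y) : ℝ :=
  sInf (surfaceDist p '' samplePoints n x y hy)

end ModularSurface

/-!
# Sparse samples of low horocycles that stay far from a given point

Write `Y n = log (n + 3)` and `ε n = 1 / (2 n Y n)`. For `Q ≥ 1` let `dirichletSet n (ε n) Q` be the
set of `x` in the circle with `‖n q x‖ ≤ ε n / Q` for some `1 ≤ q ≤ Q`. As `n q (x + j / n)` equals
`n q x` in the circle, this condition on `x` holds for all the translates `x + j / n` at once, and at
the height `y = ε n / (n Q ^ 2)` it gives `Y n * |n q z + p| ^ 2 ≤ y` for `z = x + j / n + i y` and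
some integer `p`. So each sample point has a representative of imaginary part at least `Y n`, and
lies at distance at least `log (Y n) - C` from `Γ z₀`
(`ModularSurface.exists_log_sub_le_distToSamplePoints`).

It remains to choose `Q = Q n`, as large as `y < c n` requires, so that almost every `x` is in
infinitely many of these sets. By Dirichlet's theorem the balls of radius `1 / (n d Q)` around the
points `u` of the circle for which `n • u` has order `d ≤ Q` cover the circle, while the balls with
radii shrunk by the factor `ε < 1 / 2` are disjoint and contained in the Dirichlet set. Comparing
volumes inside an open set `A` shows that for large `Q` the Dirichlet set fills at least the
proportion `ε / 2` of `A` (`eventually_mul_measureReal_le_inter_dirichletSet`). Choosing `Q n` after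
the `Q m` with `m < n`, this can be applied to the open sets of points missed since each earlier time,
whose measure is thus multiplied by at most `1 - ε n / 2` at step `n`. As `∑ 1 / (n log n)` diverges,
these measures tend to zero (`exists_seq_ae_frequently_mem`).
-/

/-! ### Distance to points high in the cusp -/

namespace ModularSurface

/-- A point `z` with `Y * |m z + p| ^ 2 ≤ Im z` for integers `m ≠ 0` and `p`, not necessarily
coprime, has a translate of imaginary part at least `Y`, so its distance to a fixed point of the
modular surface is at least `log Y` up to a constant. -/
theorem exists_log_sub_le_surfaceDist (z₀ : ℍ) : ∃ C : ℝ, ∀ (z : ℍ) (Y : ℝ) (m p : ℤ), 0 < Y →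
    m ≠ 0 → Y * Complex.normSq (m * z + p) ≤ z.im →
    Real.log Y - C ≤ surfaceDist (proj z₀) (proj z) := by
  -- The constant is the logarithm of the largest imaginary part in the orbit of `z₀`.
  obtain ⟨g₀, hg₀⟩ := ModularGroup.exists_max_im z₀
  refine ⟨Real.log (g₀ • z₀).im, fun z Y m p hY hm hz => ?_⟩
  obtain ⟨m', p', hcop, hm', hp'⟩ := Int.exists_gcd_one (Int.gcd_pos_of_ne_zero_left p hm)
  obtain ⟨γ, -, hγ⟩ := ModularGroup.bottom_row_surj (R := ℤ)
    (show ![m', p'] ∈ {cd : Fin 2 → ℤ | IsCoprime (cd 0) (cd 1)} by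
      simpa [Int.isCoprime_iff_gcd_eq_one] using hcop)
  have h0 : γ 1 0 = m' := congrFun hγ 0
  have h1 : γ 1 1 = p' := congrFun hγ 1
  set N := Complex.normSq (UpperHalfPlane.denom γ z) with hN
  have hNpos : 0 < N := UpperHalfPlane.normSq_denom_pos _ z.im_ne_zero
  have hd : UpperHalfPlane.denom γ z = m' * z + p' := by
    rw [ModularGroup.denom_apply, h0, h1]
  have hfac : Complex.normSq (m * z + p) = ((Int.gcd m p : ℕ) : ℝ) ^ 2 * N := by
    have : (m * z + p : ℂ) = (((Int.gcd m p : ℕ) : ℝ) : ℂ) * (m' * z + p') := by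
      have hmc : (m : ℂ) = m' * ((Int.gcd m p : ℕ) : ℂ) := by
        exact_mod_cast congrArg ((↑) : ℤ → ℂ) hm'
      have hpc : (p : ℂ) = p' * ((Int.gcd m p : ℕ) : ℂ) := by
        exact_mod_cast congrArg ((↑) : ℤ → ℂ) hp'
      rw [Complex.ofReal_natCast]
      linear_combination (z : ℂ) * hmc + hpc
    rw [this, ← hd, Complex.normSq_mul, Complex.normSq_ofReal, hN, sq]
  have hgcd : (1 : ℝ) ≤ ((Int.gcd m p : ℕ) : ℝ) ^ 2 := by
    have : (1 : ℝ) ≤ ((Int.gcd m p : ℕ) : ℝ) := by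
      exact_mod_cast Int.gcd_pos_of_ne_zero_left p hm
    nlinarith
  have hγz : Y ≤ (γ • z).im := by
    rw [ModularGroup.im_smul_eq_div_normSq, le_div_iff₀ hNpos]
    rw [hfac] at hz
    nlinarith [mul_pos hY hNpos]
  rw [surfaceDist_proj]
  refine le_ciInf fun δ => ?_
  rw [← dist_smul_smul γ, smul_smul]
  have h2 := UpperHalfPlane.dist_log_im_le ((γ * δ) • z₀) (γ • z)
  rw [Real.dist_eq] at h2
  have h3 : Real.log ((γ * δ) • z₀).im ≤ Real.log (g₀ • z₀).im :=
    Real.log_le_log (UpperHalfPlane.im_pos _) (hg₀ _)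
  have h4 := Real.log_le_log hY hγz
  have h5 := neg_le_abs (Real.log ((γ * δ) • z₀).im - Real.log (γ • z).im)
  linarith

end ModularSurface

/-! ### Sample points over a Dirichlet set -/

/-- The points `x` of the circle for which `n • x` is within the `ε`-fold of Dirichlet's bound at
level `Q`: some `1 ≤ q ≤ Q` has `‖q • (n • x)‖ ≤ ε / Q`. Here `‖·‖` is the distance to the nearest
integer. No coprimality is required of the approximating fractions. -/
def dirichletSet (n : ℕ) (ε : ℝ) (Q : ℕ) : Set UnitAddCircle :=
  {x | ∃ q ∈ Finset.Icc 1 Q, ‖(n * q) • x‖ ≤ ε / Q}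

theorem isClosed_dirichletSet (n : ℕ) (ε : ℝ) (Q : ℕ) : IsClosed (dirichletSet n ε Q) := by
  have : dirichletSet n ε Q = ⋃ q ∈ Finset.Icc 1 Q, {x | ‖(n * q) • x‖ ≤ ε / Q} := by
    ext x; simp [dirichletSet]
  rw [this]
  exact (Finset.Icc 1 Q).finite_toSet.isClosed_biUnion fun q _ =>
    isClosed_le (by fun_prop) continuous_const

namespace ModularSurface

/-- The height `y = ε / (n Q ^ 2)` with `ε = 1 / (2 n Y)` balances the two terms of
`|n q z + p| ^ 2 ≤ (ε / Q) ^ 2 + (n Q y) ^ 2`: their sum is then `y / Y`. -/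
theorem exists_log_sub_le_distToSamplePoints (z₀ : ℍ) : ∃ C : ℝ, ∀ (n : ℕ+) (Y : ℝ) (Q : ℕ)
    (y : ℝ) (hy : 0 < y) (x : UnitAddCircle), 0 < Y → 0 < Q →
    y = 1 / (2 * n * Y) / (n * Q ^ 2) →
    x ∈ dirichletSet n (1 / (2 * n * Y)) Q →
    Real.log Y - C ≤ distToSamplePoints (proj z₀) n x y hy := by
  obtain ⟨C, hC⟩ := exists_log_sub_le_surfaceDist z₀
  refine ⟨C, fun n Y Q y hy x hY hQ hyQ ⟨q, hq, hx⟩ => ?_⟩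
  rw [Finset.mem_Icc] at hq
  have hn : (0 : ℝ) < (n : ℕ) := by exact_mod_cast n.pos
  have hQ' : (0 : ℝ) < Q := by exact_mod_cast hQ
  refine le_csInf (Set.Nonempty.image _ ⟨_, 0, n.pos, rfl⟩) ?_
  rintro _ ⟨_, ⟨j, -, rfl⟩, rfl⟩
  -- The condition defining the Dirichlet set is invariant under translation by `j / n`.
  have hj : ((n : ℕ) * q) • (x + (((j : ℝ) / ((n : ℕ) : ℝ) : ℝ) : UnitAddCircle)) =
      ((n : ℕ) * q) • x := by
    rw [nsmul_add, ← AddCircle.coe_nsmul]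
    have : ((n : ℕ) * q) • ((j : ℝ) / ((n : ℕ) : ℝ)) = ((q * j : ℕ) : ℤ) • (1 : ℝ) := by
      simp only [nsmul_eq_mul, zsmul_eq_mul]
      push_cast
      field_simp
    rw [this, AddCircle.coe_zsmul, AddCircle.coe_period, smul_zero, add_zero]
  obtain ⟨s, hs⟩ := QuotientAddGroup.mk_surjective
    (x + (((j : ℝ) / ((n : ℕ) : ℝ) : ℝ) : UnitAddCircle))
  change (s : UnitAddCircle) = _ at hs
  rw [← hj, ← hs, ← AddCircle.coe_nsmul, UnitAddCircle.norm_eq, nsmul_eq_mul] at hx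
  rw [← hs, horocyclePoint_coe]
  set p := round (((((n : ℕ) * q : ℕ) : ℝ)) * s)
  refine hC _ Y (((n : ℕ) * q : ℕ) : ℤ) (-p) hY ?_ ?_
  · exact_mod_cast (Nat.mul_pos n.pos hq.1).ne'
  · have hq' : (q : ℝ) ≤ Q := by exact_mod_cast hq.2
    have him : (halfPlanePoint y hy s).im = y := rfl
    have hns : Complex.normSq (((((n : ℕ) * q : ℕ) : ℤ) : ℂ) * (halfPlanePoint y hy s : ℂ)
        + ((-p : ℤ) : ℂ)) = (((((n : ℕ) * q : ℕ) : ℝ)) * s - p) ^ 2 + (n * q * y) ^ 2 := by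
      rw [Complex.normSq_apply]
      simp [halfPlanePoint]
      ring
    rw [him, hns]
    have h1 : (((((n : ℕ) * q : ℕ) : ℝ)) * s - p) ^ 2 ≤ (1 / (2 * n * Y) / Q) ^ 2 := by
      rw [← sq_abs]; gcongr
    have h2 : ((n : ℕ) * q * y) ^ 2 ≤ (n * Q * y : ℝ) ^ 2 := by gcongr
    calc Y * _ ≤ Y * ((1 / (2 * n * Y) / Q) ^ 2 + (n * Q * y : ℝ) ^ 2) := by gcongr
      _ = y := by
        rw [hyQ]; field_simp; ring

end ModularSurface

/-! ### The proportion of a Dirichlet set in an open set -/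

/-- Dirichlet's approximation theorem for `n • x`, pulled back to `x`. -/
theorem exists_torsion_norm_sub_le {n Q : ℕ} (hn : 0 < n) (hQ : 0 < Q) (x : UnitAddCircle) :
    ∃ u : UnitAddCircle, (0 < addOrderOf (n • u) ∧ addOrderOf (n • u) ≤ Q) ∧
      ‖x - u‖ ≤ 1 / (n * addOrderOf (n • u) * Q) := by
  obtain ⟨ξ, rfl⟩ := QuotientAddGroup.mk_surjective x
  obtain ⟨r, hr, hrQ⟩ := Real.exists_rat_abs_sub_le_and_den_le (n * ξ) hQ
  have hn' : (0 : ℝ) < n := by exact_mod_cast hn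
  have hQ' : (0 : ℝ) < Q := by exact_mod_cast hQ
  have hu : n • ((r / n : ℝ) : UnitAddCircle) = ((r : ℝ) : UnitAddCircle) := by
    rw [← AddCircle.coe_nsmul, nsmul_eq_mul, mul_div_cancel₀ _ hn'.ne']
  have h0 : r.den • ((r : ℝ) : UnitAddCircle) = 0 := by
    have : r.den • (r : ℝ) = r.num • (1 : ℝ) := by
      rw [nsmul_eq_mul, zsmul_eq_mul, mul_one, mul_comm]
      exact_mod_cast r.mul_den_eq_num
    rw [← AddCircle.coe_nsmul, this, AddCircle.coe_zsmul, AddCircle.coe_period, smul_zero]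
  have hle : addOrderOf ((r : ℝ) : UnitAddCircle) ≤ r.den := addOrderOf_le_of_nsmul_eq_zero r.pos h0
  have hpos : 0 < addOrderOf ((r : ℝ) : UnitAddCircle) :=
    (isOfFinAddOrder_iff_nsmul_eq_zero.2 ⟨_, r.pos, h0⟩).addOrderOf_pos
  refine ⟨((r / n : ℝ) : UnitAddCircle), ?_⟩
  rw [hu]
  refine ⟨⟨hpos, hle.trans hrQ⟩, ?_⟩
  have hle' : (addOrderOf ((r : ℝ) : UnitAddCircle) : ℝ) ≤ r.den := by exact_mod_cast hle
  have hpos' : (0 : ℝ) < addOrderOf ((r : ℝ) : UnitAddCircle) := by exact_mod_cast hpos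
  have hsub : ‖(ξ : UnitAddCircle) - ((r / n : ℝ) : UnitAddCircle)‖ ≤ |ξ - r / n| := by
    rw [← AddCircle.coe_sub, UnitAddCircle.norm_eq]
    simpa using round_le (ξ - r / n) 0
  refine hsub.trans ?_
  have : ξ - r / n = (n * ξ - r) / n := by field_simp
  rw [this, abs_div, abs_of_pos hn', div_le_iff₀ hn']
  calc |n * ξ - r| ≤ 1 / ((Q + 1) * r.den) := hr
    _ ≤ 1 / (Q * addOrderOf ((r : ℝ) : UnitAddCircle)) := by gcongr; linarith
    _ = _ := by field_simp

theorem one_div_le_norm_sub {u v : UnitAddCircle} {n : ℕ} (hn : 0 < n)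
    (hu : 0 < addOrderOf (n • u)) (hv : 0 < addOrderOf (n • v)) (huv : u ≠ v) :
    1 / (n * addOrderOf (n • u) * addOrderOf (n • v) : ℝ) ≤ ‖u - v‖ := by
  have h0 : (n * addOrderOf (n • u) * addOrderOf (n • v)) • (u - v) = 0 := by
    have h1 : (n * addOrderOf (n • u) * addOrderOf (n • v)) • u = 0 := by
      rw [mul_comm, mul_nsmul', mul_comm n, mul_nsmul', addOrderOf_nsmul_eq_zero, smul_zero]
    have h2 : (n * addOrderOf (n • u) * addOrderOf (n • v)) • v = 0 := by
      rw [mul_comm n, mul_assoc, mul_comm n, mul_nsmul', mul_nsmul',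
        addOrderOf_nsmul_eq_zero, smul_zero]
    rw [nsmul_sub, h1, h2, sub_zero]
  have hpos := Nat.mul_pos (Nat.mul_pos hn hu) hv
  have hpos' : (0 : ℝ) < n * addOrderOf (n • u) * addOrderOf (n • v) := by exact_mod_cast hpos
  have h3 := AddCircle.le_add_order_smul_norm_of_isOfFinAddOrder
    (isOfFinAddOrder_iff_nsmul_eq_zero.2 ⟨_, hpos, h0⟩) (sub_ne_zero.2 huv)
  rw [div_le_iff₀' hpos']
  refine h3.trans ?_
  rw [nsmul_eq_mul]
  have h4 : (addOrderOf (u - v) : ℝ) ≤ n * addOrderOf (n • u) * addOrderOf (n • v) := by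
    exact_mod_cast addOrderOf_le_of_nsmul_eq_zero hpos h0
  gcongr

/-- Inside `A`, the disjoint balls of radius `ε / (n d Q)` have at least the `ε`-fold of the total
volume of the balls of radius `1 / (n d Q)` with the same centres, and the latter cover every point
whose distance to the complement of `A` exceeds `2 / Q`. -/
theorem mul_volume_le_volume_inter_dirichletSet {n Q : ℕ} (hn : 0 < n) (hQ : 0 < Q) {ε : ℝ}
    (hε0 : 0 ≤ ε) (hε : ε < 1 / 2) (A : Set UnitAddCircle) :
    ENNReal.ofReal ε * volume {x | Metric.closedBall x (2 / Q) ⊆ A} ≤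
      volume (A ∩ dirichletSet n ε Q) := by
  have hn1 : (1 : ℝ) ≤ n := by exact_mod_cast hn
  have hQ1 : (1 : ℝ) ≤ Q := by exact_mod_cast hQ
  let d : UnitAddCircle → ℕ := fun u => addOrderOf (n • u)
  let ρ : UnitAddCircle → ℝ := fun u => 1 / (n * d u * Q)
  let S : Set UnitAddCircle :=
    {u | (0 < d u ∧ d u ≤ Q) ∧ Metric.closedBall u (ρ u) ⊆ A}
  have hd : ∀ u ∈ S, (1 : ℝ) ≤ d u := fun u hu => by exact_mod_cast hu.1.1
  have hρ0 : ∀ u, 0 ≤ ρ u := fun u => by positivity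
  have hρ1 : ∀ u ∈ S, ρ u ≤ 1 := fun u hu =>
    div_le_one_of_le₀ (one_le_mul_of_one_le_of_one_le
      (one_le_mul_of_one_le_of_one_le hn1 (hd u hu)) hQ1) (by positivity)
  have hScount : S.Countable := by
    have hfin : (⋃ q ∈ Finset.Icc 1 Q, {u : UnitAddCircle | (q * n) • u = 0}).Finite :=
      (Finset.Icc 1 Q).finite_toSet.biUnion fun q hq =>
        AddCircle.finite_torsion 1 (Nat.mul_pos (Finset.mem_Icc.1 hq).1 hn)
    refine (hfin.subset fun u hu => ?_).countable
    simp only [Set.mem_iUnion]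
    exact ⟨d u, Finset.mem_Icc.2 hu.1, by
      simp only [Set.mem_ofPred_eq, mul_nsmul', d, addOrderOf_nsmul_eq_zero]⟩
  have hcover : {x | Metric.closedBall x (2 / Q) ⊆ A} ⊆ ⋃ u ∈ S, Metric.closedBall u (ρ u) := by
    intro x hx
    obtain ⟨u, hu, hxu⟩ := exists_torsion_norm_sub_le hn hQ x
    have hρQ : ρ u ≤ 1 / Q := by
      have : (1 : ℝ) ≤ d u := by exact_mod_cast hu.1
      exact one_div_le_one_div_of_le (by linarith)
        (le_mul_of_one_le_left (by linarith) (one_le_mul_of_one_le_of_one_le hn1 this))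
    have hxu' : dist x u ≤ ρ u := by rwa [dist_eq_norm]
    refine Set.mem_biUnion (x := u) ⟨hu, ?_⟩ hxu'
    refine (Metric.closedBall_subset_closedBall' ?_).trans hx
    rw [dist_comm]
    calc ρ u + dist x u ≤ 1 / Q + 1 / Q := by linarith
      _ = 2 / Q := by ring
  have hsub : ⋃ u ∈ S, Metric.closedBall u (ε * ρ u) ⊆ A ∩ dirichletSet n ε Q := by
    refine Set.iUnion₂_subset fun u hu x hx => ⟨hu.2 ?_, d u, Finset.mem_Icc.2 hu.1, ?_⟩
    · exact Metric.closedBall_subset_closedBall (by nlinarith [hρ0 u]) hx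
    · have h0 : (n * d u) • u = 0 := by
        rw [mul_comm, mul_nsmul', addOrderOf_nsmul_eq_zero]
      rw [Metric.mem_closedBall, dist_eq_norm] at hx
      have hdu := hd u hu
      calc ‖(n * d u) • x‖ = ‖(n * d u) • (x - u)‖ := by rw [nsmul_sub, h0, sub_zero]
        _ ≤ (n * d u : ℕ) * ‖x - u‖ := norm_nsmul_le
        _ ≤ (n * d u : ℕ) * (ε * ρ u) := by gcongr
        _ = ε / Q := by simp only [ρ]; push_cast; field_simp
  -- Distinct centres of orders `d, d' ≤ Q` are `1 / (n d d')` apart, and both radii are at most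
  -- `ε / (n d d')` with `2 ε < 1`.
  have hdisj : S.PairwiseDisjoint fun u => Metric.closedBall u (ε * ρ u) := by
    intro u hu v hv huv
    refine Metric.closedBall_disjoint_closedBall ?_
    rw [dist_eq_norm]
    refine lt_of_lt_of_le ?_ (one_div_le_norm_sub hn hu.1.1 hv.1.1 huv)
    have hdu := hd u hu
    have hdv := hd v hv
    have h1 : ρ u ≤ 1 / (n * d u * d v) := by
      simp only [ρ]; gcongr; exact hv.1.2
    have h2 : ρ v ≤ 1 / (n * d u * d v) := by
      simp only [ρ]; rw [mul_right_comm]; gcongr; exact hu.1.2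
    have h3 : (0 : ℝ) < 1 / (n * d u * d v) := by positivity
    change _ < 1 / (n * d u * d v : ℝ)
    nlinarith
  have hvol : ∀ u ∈ S, ENNReal.ofReal ε * volume (Metric.closedBall u (ρ u)) ≤
      volume (Metric.closedBall u (ε * ρ u)) := by
    intro u hu
    have h1 : 2 * (ε * ρ u) ≤ 1 := by nlinarith [hρ1 u hu, hρ0 u]
    rw [AddCircle.volume_closedBall, AddCircle.volume_closedBall, min_eq_right h1,
      ← ENNReal.ofReal_mul hε0]
    refine ENNReal.ofReal_le_ofReal ?_
    calc ε * min 1 (2 * ρ u) ≤ ε * (2 * ρ u) := by gcongr; exact min_le_right _ _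
      _ = _ := by ring
  calc ENNReal.ofReal ε * volume {x | Metric.closedBall x (2 / Q) ⊆ A}
      ≤ ENNReal.ofReal ε * ∑' u : S, volume (Metric.closedBall (u : UnitAddCircle) (ρ u)) := by
        gcongr
        exact (measure_mono hcover).trans (measure_biUnion_le _ hScount _)
    _ = ∑' u : S, ENNReal.ofReal ε * volume (Metric.closedBall (u : UnitAddCircle) (ρ u)) :=
        ENNReal.tsum_mul_left.symm
    _ ≤ ∑' u : S, volume (Metric.closedBall (u : UnitAddCircle) (ε * ρ u)) :=
        ENNReal.tsum_le_tsum fun u => hvol u u.2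
    _ = volume (⋃ u ∈ S, Metric.closedBall u (ε * ρ u)) :=
        (measure_biUnion hScount hdisj fun _ _ => Metric.isClosed_closedBall.measurableSet).symm
    _ ≤ volume (A ∩ dirichletSet n ε Q) := measure_mono hsub

theorem eventually_mul_measureReal_le_inter_dirichletSet {n : ℕ} (hn : 0 < n) {ε : ℝ}
    (hε0 : 0 ≤ ε) (hε : ε < 1 / 2) {A : Set UnitAddCircle} (hA : IsOpen A) :
    ∀ᶠ Q : ℕ in atTop, ε / 2 * volume.real A ≤ volume.real (A ∩ dirichletSet n ε Q) := by
  rcases (measureReal_nonneg (μ := volume) (s := A)).eq_or_lt with h0 | hpos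
  · exact Eventually.of_forall fun Q => by rw [← h0, mul_zero]; exact measureReal_nonneg
  let B : ℕ → Set UnitAddCircle := fun Q => {x | Metric.closedBall x (2 / Q) ⊆ A}
  have hmono : Monotone fun m => B (m + 1) := by
    intro m m' hm x hx
    refine (Metric.closedBall_subset_closedBall ?_).trans hx
    have : (m : ℝ) ≤ m' := by exact_mod_cast hm
    push_cast
    gcongr
  have hunion : ⋃ m, B (m + 1) = A := by
    refine Set.Subset.antisymm (Set.iUnion_subset fun m x hx =>
      hx (Metric.mem_closedBall_self (by positivity))) fun x hx => ?_
    obtain ⟨δ, hδ, hball⟩ := Metric.nhds_basis_closedBall.mem_iff.1 (hA.mem_nhds hx)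
    obtain ⟨m, hm⟩ := exists_nat_gt (2 / δ)
    refine Set.mem_iUnion.2 ⟨m, (Metric.closedBall_subset_closedBall ?_).trans hball⟩
    rw [div_lt_iff₀ hδ] at hm
    rw [div_le_iff₀ (by positivity)]
    push_cast
    nlinarith
  have htend : Tendsto (fun m => volume.real (B (m + 1))) atTop (nhds (volume.real A)) := by
    have h := tendsto_measure_iUnion_atTop (μ := volume) hmono
    rw [hunion] at h
    exact (ENNReal.tendsto_toReal (measure_ne_top _ _)).comp h
  have hev := (tendsto_add_atTop_iff_nat (f := fun m => volume.real (B m)) 1).1 htend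
  filter_upwards [hev.eventually (lt_mem_nhds (half_lt_self hpos)), eventually_gt_atTop 0]
    with Q hQ hQ0
  have h := ENNReal.toReal_mono (measure_ne_top _ _)
    (mul_volume_le_volume_inter_dirichletSet hn hQ0 hε0 hε A)
  rw [ENNReal.toReal_mul, ENNReal.toReal_ofReal hε0] at h
  change ε * volume.real (B Q) ≤ volume.real _ at h
  nlinarith

/-! ### Divergence of the sum of `1 / (n log n)` -/

theorem not_summable_one_div_mul_log :
    ¬ Summable fun n : ℕ => 1 / (2 * ((n : ℝ) + 1) * Real.log (n + 4)) := by
  have hlog : ∀ n : ℕ, 0 < Real.log ((n : ℝ) + 4) := fun n =>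
    Real.log_pos (by linarith [n.cast_nonneg (α := ℝ)])
  rw [← summable_condensed_iff_of_nonneg (fun n => by have := hlog n; positivity)
    (fun m n _ h => by
      have := hlog m
      have h' : (m : ℝ) ≤ n := by exact_mod_cast h
      gcongr)]
  intro hs
  refine Real.not_summable_one_div_natCast ((summable_nat_add_iff 3).1
    (Summable.of_nonneg_of_le (fun n => by positivity) (fun k => ?_) (hs.mul_left 4)))
  have h2 : (1 : ℝ) ≤ 2 ^ k := one_le_pow₀ (by norm_num)
  have h3 : Real.log ((2 : ℝ) ^ k + 4) ≤ (k + 3 : ℕ) := by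
    calc Real.log ((2 : ℝ) ^ k + 4) ≤ Real.log ((2 : ℝ) ^ (k + 3)) :=
          Real.log_le_log (by positivity) (by rw [pow_add]; linarith)
      _ = (k + 3 : ℕ) * Real.log 2 := by rw [Real.log_pow]
      _ ≤ (k + 3 : ℕ) * 1 := by
          gcongr
          linarith [Real.log_two_lt_d9]
      _ = _ := mul_one _
  have h4 : 0 < Real.log ((2 : ℝ) ^ k + 4) := by exact_mod_cast hlog (2 ^ k)
  push_cast
  calc 1 / ((k : ℝ) + 3) ≤ 1 / Real.log ((2 : ℝ) ^ k + 4) := by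
        gcongr; exact_mod_cast h3
    _ = 4 * (2 ^ k * (1 / (2 * (2 ^ k + 2 ^ k) * Real.log (2 ^ k + 4)))) := by
        field_simp; ring
    _ ≤ _ := by gcongr

/-! ### A second Borel–Cantelli lemma with inductive choice -/

/-- A divergence Borel–Cantelli lemma in which independence is replaced by freedom of choice: if
`E n Q` eventually fills the proportion `ε n` of any given open set as `Q` grows, and `∑ ε n`
diverges, then `Q n` can be chosen, subject to any condition that holds for all large values, so that
almost every point is in infinitely many of the sets `E n (Q n)`. -/
theorem exists_seq_ae_frequently_mem {X : Type*} [TopologicalSpace X] [MeasurableSpace X]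
    [BorelSpace X] (μ : Measure X) [IsProbabilityMeasure μ] (E : ℕ → ℕ → Set X)
    (hE : ∀ n Q, IsClosed (E n Q)) (ε : ℕ → ℝ) (hε : ∀ n, 0 ≤ ε n) (hsum : ¬ Summable ε)
    (h : ∀ n (A : Set X), IsOpen A → ∀ᶠ Q in atTop, ε n * μ.real A ≤ μ.real (A ∩ E n Q))
    (P : ℕ → ℕ → Prop) (hP : ∀ n, ∀ᶠ Q in atTop, P n Q) :
    ∃ Q : ℕ → ℕ, (∀ n, P n (Q n)) ∧ ∀ᵐ x ∂μ, ∃ᶠ n in atTop, x ∈ E n (Q n) := by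
  -- The points missed by the sets with indices in `[k, n)`, for the choices recorded in `g`.
  let A : (ℕ → ℕ) → ℕ → ℕ → Set X := fun g k n => ⋂ i ∈ Finset.Ico k n, (E i (g i))ᶜ
  have hA : ∀ g k n, IsOpen (A g k n) := fun g k n =>
    isOpen_biInter_finset fun i _ => (hE i (g i)).isOpen_compl
  have key : ∀ n g, ∃ q, P n q ∧
      ∀ k ∈ Finset.range (n + 1), ε n * μ.real (A g k n) ≤ μ.real (A g k n ∩ E n q) := fun n g =>
    ((hP n).and ((Finset.range (n + 1)).eventually_all.2 fun k _ => h n _ (hA g k n))).exists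
  choose F hFP hF using key
  -- `S n` records the choices with indices below `n`, and is `0` elsewhere.
  let S : ℕ → ℕ → ℕ := fun n => Nat.rec 0 (fun m g => Function.update g m (F m g)) n
  have hS : ∀ m, S (m + 1) = Function.update (S m) m (F m (S m)) := fun m => rfl
  let Q : ℕ → ℕ := fun n => F n (S n)
  have hSQ : ∀ m, ∀ i < m, S m i = Q i := by
    intro m
    induction m with
    | zero => intro i hi; omega
    | succ m ih =>
      intro i hi
      rw [hS]
      rcases Nat.lt_succ_iff_lt_or_eq.1 hi with h | rfl
      · rw [Function.update_of_ne h.ne, ih i h]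
      · rw [Function.update_self]
  have hAQ : ∀ k n, A (S n) k n = A Q k n := fun k n =>
    Set.iInter₂_congr fun i hi => by rw [hSQ n i (Finset.mem_Ico.1 hi).2]
  refine ⟨Q, fun n => hFP n _, ?_⟩
  have hstep : ∀ k n, k ≤ n → μ.real (A Q k (n + 1)) ≤ Real.exp (-ε n) * μ.real (A Q k n) := by
    intro k n hkn
    have h1 := hF n (S n) k (Finset.mem_range.2 (by omega))
    rw [hAQ] at h1
    have h2 : A Q k (n + 1) = A Q k n \ E n (Q n) := by
      simp only [A, Set.sdiff_eq]
      rw [← Finset.insert_Ico_right_eq_Ico_add_one hkn, Finset.set_biInter_insert, Set.inter_comm]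
    have h3 := measureReal_inter_add_sdiff (μ := μ) (s := A Q k n) (hE n (Q n)).measurableSet
    have h4 := Real.one_sub_le_exp_neg (ε n)
    have h5 : 0 ≤ μ.real (A Q k n) := measureReal_nonneg
    rw [h2]
    change ε n * μ.real (A Q k n) ≤ μ.real (A Q k n ∩ E n (Q n)) at h1
    nlinarith
  have hbound : ∀ k n, μ.real (A Q k (k + n)) ≤
      Real.exp (-∑ i ∈ Finset.range n, ε (i + k)) := by
    intro k n
    induction n with
    | zero => simp
    | succ n ih =>
      refine (hstep k (k + n) (by omega)).trans ?_
      rw [Finset.sum_range_succ, neg_add, Real.exp_add, mul_comm, add_comm n k]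
      gcongr
  have hnull : ∀ k, μ {x | ∀ n, k ≤ n → x ∉ E n (Q n)} = 0 := by
    intro k
    have hdiv : Tendsto (fun n => ∑ i ∈ Finset.range n, ε (i + k)) atTop atTop :=
      (not_summable_iff_tendsto_nat_atTop_of_nonneg fun i => hε (i + k)).1
        (mt (summable_nat_add_iff k).1 hsum)
    have hz : Tendsto (fun n => Real.exp (-∑ i ∈ Finset.range n, ε (i + k))) atTop (nhds 0) :=
      Real.tendsto_exp_neg_atTop_nhds_zero.comp hdiv
    rw [← measureReal_eq_zero_iff]
    refine le_antisymm (ge_of_tendsto' hz fun n => (measureReal_mono ?_).trans (hbound k n))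
      measureReal_nonneg
    intro x hx
    simp only [A, Set.mem_iInter]
    exact fun i hi => hx i (Finset.mem_Ico.1 hi).1
  have hae : ∀ᵐ x ∂μ, ∀ k, ¬ ∀ n, k ≤ n → x ∉ E n (Q n) := ae_all_iff.2 fun k => by
    rw [ae_iff]; simp [hnull k]
  filter_upwards [hae] with x hx
  rw [frequently_atTop]
  intro k
  simpa using hx k

/-! ### The limsup along the sequence of heights -/

theorem one_le_limsup_of_frequently {f : ℕ+ → ℝ} {C : ℝ}
    (hf : ∃ᶠ n : ℕ+ in atTop, Real.log (Real.log ((n : ℕ) + 3)) - C ≤ f n) :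
    (1 : EReal) ≤ limsup (fun n : ℕ+ =>
      ((f n / Real.log (Real.log ((n : ℕ) : ℝ)) : ℝ) : EReal)) atTop := by
  have hcast : Tendsto (fun n : ℕ+ => ((n : ℕ) : ℝ)) atTop atTop :=
    tendsto_natCast_atTop_atTop.comp tendsto_PNat_val_atTop_atTop
  have hlog := Real.tendsto_log_atTop.comp hcast
  have hloglog := Real.tendsto_log_atTop.comp hlog
  refine le_of_forall_lt fun b hb => ?_
  obtain ⟨a, hba, ha⟩ := EReal.lt_iff_exists_real_btwn.1 hb
  have ha1 : a < 1 := by exact_mod_cast ha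
  refine hba.trans_le (le_limsup_of_frequently_le ?_)
  have hev := (hcast.eventually_gt_atTop 0).and ((hlog.eventually_gt_atTop 0).and
    ((hloglog.eventually_gt_atTop 0).and (hloglog.eventually_ge_atTop (C / (1 - a)))))
  refine (hf.and_eventually hev).mono fun n ⟨hn, h0, h1, h2, h3⟩ => ?_
  simp only [Function.comp_apply] at h1 h2 h3
  have h4 : Real.log (Real.log ((n : ℕ) : ℝ)) ≤ Real.log (Real.log ((n : ℕ) + 3)) :=
    Real.log_le_log h1 (Real.log_le_log h0 (by linarith))
  rw [div_le_iff₀ (sub_pos.2 ha1)] at h3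
  rw [EReal.coe_le_coe_iff, le_div_iff₀ h2]
  linarith

theorem theorem1p6 (z₀ : ℍ) (c : ℕ+ → ℝ) (hc : ∀ n, 0 < c n) :
    ∃ (y : ℕ+ → ℝ) (hy : ∀ n, 0 < y n), (∀ n, y n < c n) ∧
      ∀ᵐ x ∂(volume : Measure UnitAddCircle),
        (1 : EReal) ≤ limsup (fun n : ℕ+ =>
          ((ModularSurface.distToSamplePoints (ModularSurface.proj z₀) n x (y n) (hy n) /
            Real.log (Real.log ((n : ℕ) : ℝ)) : ℝ) : EReal)) atTop := by
  obtain ⟨C, hC⟩ := ModularSurface.exists_log_sub_le_distToSamplePoints z₀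
  -- The shift by `3` makes `Y n > 1` for every `n`, hence `ε n < 1 / 2` for `n ≥ 1`.
  let Y : ℕ → ℝ := fun n => Real.log (n + 3)
  let ε : ℕ → ℝ := fun n => 1 / (2 * n * Y n)
  have hY : ∀ n, 1 < Y n := fun n => by
    rw [Real.lt_log_iff_exp_lt (by positivity)]
    linarith [Real.exp_one_lt_d9, n.cast_nonneg (α := ℝ)]
  have hε0 : ∀ n, 0 < n → 0 < ε n := fun n hn => by
    have := hY n
    positivity
  have hε : ∀ n, 0 < n → ε n < 1 / 2 := fun n hn => by
    have h1 := hY n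
    have h2 : (1 : ℝ) ≤ n := by exact_mod_cast hn
    exact one_div_lt_one_div_of_lt two_pos (by nlinarith)
  -- The index `i : ℕ` of the inductive choice stands for the sample size `n = i + 1`.
  have hsum : ¬ Summable fun i : ℕ => ε (i + 1) / 2 := fun h => by
    refine not_summable_one_div_mul_log ((h.mul_left 2).congr fun i => ?_)
    simp only [ε, Y]
    push_cast
    rw [add_assoc (i : ℝ) 1 3, mul_div_cancel₀ _ two_ne_zero]
    norm_num
  have : IsProbabilityMeasure (volume : Measure UnitAddCircle) := ⟨UnitAddCircle.measure_univ⟩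
  obtain ⟨Q, hQ, hae⟩ := exists_seq_ae_frequently_mem (volume : Measure UnitAddCircle)
    (fun i Q => dirichletSet (i + 1) (ε (i + 1)) Q) (fun i Q => isClosed_dirichletSet _ _ _)
    (fun i => ε (i + 1) / 2) (fun i => (half_pos (hε0 _ i.succ_pos)).le) hsum
    (fun i A hA => eventually_mul_measureReal_le_inter_dirichletSet i.succ_pos
      (hε0 _ i.succ_pos).le (hε _ i.succ_pos) hA)
    (fun i Q => 0 < Q ∧ ε (i + 1) / ((i + 1 : ℕ) * (Q : ℝ) ^ 2) < c i.succPNat) (fun i => by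
      refine (eventually_gt_atTop 0).and ?_
      have h : Tendsto (fun Q : ℕ => ε (i + 1) / ((i + 1 : ℕ) * (Q : ℝ) ^ 2)) atTop (nhds 0) :=
        (((tendsto_pow_atTop two_ne_zero).comp tendsto_natCast_atTop_atTop).const_mul_atTop
          (by positivity)).const_div_atTop _
      exact h.eventually (gt_mem_nhds (hc _)))
  have hy : ∀ n : ℕ+, 0 < ε n / ((n : ℕ) * (Q n.natPred : ℝ) ^ 2) := fun n => by
    have h1 := hε0 n n.pos
    have h2 := (hQ n.natPred).1
    have h3 := n.pos
    positivity
  refine ⟨fun n => ε n / ((n : ℕ) * (Q n.natPred : ℝ) ^ 2), hy, fun n => ?_, ?_⟩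
  · have h := (hQ n.natPred).2
    rwa [PNat.natPred_add_one, PNat.succPNat_natPred] at h
  · filter_upwards [hae] with x hx
    refine one_le_limsup_of_frequently (C := C) ?_
    rw [frequently_atTop] at hx ⊢
    intro N
    obtain ⟨i, hi, hxi⟩ := hx N
    refine ⟨i.succPNat, ?_, ?_⟩
    · rw [← PNat.coe_le_coe, Nat.succPNat_coe]; omega
    · refine hC i.succPNat (Y (i.succPNat : ℕ)) (Q i) _ _ x ((zero_lt_one.trans (hY _)))
        (hQ i).1 ?_ hxi
      rw [Nat.natPred_succPNat]
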